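/- Let $k$ be a field and let $(Q,\mathcal{P})$ be a thread quiver: a quiver $Q=(Q_0,Q_1,s,t)$, possibly infinite, together with a (possibly empty) linearly ordered set $\mathcal{P}_\alpha$ for every arrow $\alpha\in Q_1$. Let $\overline{\mathcal{P}}_\alpha$ be $\mathcal{P}_\alpha$ with a new minimum, identified with $s(\alpha)$, and a new maximum, identified with $t(\alpha)$. The path category $\mathcal{C}$ of $(Q,\mathcal{P})$ is the $k$-linear category whose set of objects is $Q_0\sqcup\bigsqcup_{\alpha\in Q_1}\mathcal{P}_\alpha$ and whose Hom spaces have the following bases of path-like elements, where $x\in\mathcal{P}_\alpha$, $y\in\mathcal{P}_\beta$, $a,b\in Q_0$: - from $a$ to $b$: the paths of $Q$ from $a$ to $b$; - from $a$ to $y$: the elements $\eta_{y,s(\beta)}\,p$ with $p$ a path from $a$ to $s(\beta)$; - from $x$ to $b$: the elements $p\,\eta_{t(\alpha),x}$ with $p$ a path from $t(\alpha)$ to $b$; - from $x$ to $y$: the elements $\eta_{y,s(\beta)}\,p\,\eta_{t(\alpha),x}$ with $p$ a path from $t(\alpha)$ to $s(\beta)$ and, if $\alpha=\beta$ and $x\le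 y$, one further element $\eta_{y,x}$. Composition is the bilinear extension of concatenation, subject to $\eta_{x,x}=\mathrm{id}_x$, $\eta_{z,y}\eta_{y,x}=\eta_{z,x}$ for $x\le y\le z$ in $\overline{\mathcal{P}}_\alpha$ with $y\in\mathcal{P}_\alpha$, where $\eta$ from $s(\alpha)$ to $t(\alpha)$ along $\overline{\mathcal{P}}_\alpha$ means $\alpha$ (also when $\alpha$ is a loop). A pointwise finite-dimensional representation of $\mathcal{C}$ is a covariant $k$-linear functor $M$ from $\mathcal{C}$ to finite-dimensional $k$-vector spaces; its support is $\operatorname{supp}(M)=\{x : M(x)\neq 0\}$. Such an $M$ is called noise if $\operatorname{supp}(M)\cap Q_0=\emptyset$, and noise free if it has no nonzero direct summand that is noise. **Theorem.** Let $M$ be a pointwise finite-dimensional representation of $\mathcal{C}$. Then there are pointwise finite-dimensional representations $M_{NF}$, noise free, and $M_N$, noise, with $M\cong M_{NF}\oplus M_N$. This decomposition is unique up to isomorphism of summands: if also $M\cong M'_{NF}\oplus M'_N$ with $M'_{NF}$ noise free and $M'_N$ noise, then $M_{NF}\cong M'_{NF}$ and $M_N\cong M'_N$. Moreover, $M_N\cong\bigoplus_{\alpha\in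 Q_1}U_\alpha$ for pointwise finite-dimensional representations $U_\alpha$ of $\mathcal{C}$ with $\operatorname{supp}(U_\alpha)\subseteq\mathcal{P}_\alpha$ for every $\alpha\in Q_1$. -/

import Mathlib

open CategoryTheory CategoryTheory.Limits

universe w uP v u uk

/-- A threading of a quiver `V`: a linearly ordered set (possibly empty) for every arrow.
A thread quiver is a quiver together with a threading. -/
structure Threading (V : Type u) [Quiver.{v} V] where
  /-- The linearly ordered set attached to the arrow `α`. -/
  P : ∀ {a b : V}, (a ⟶ b) → Type uP
  /-- Its linear order. -/
  ord : ∀ {a b : V} (α : a ⟶ b), LinearOrder (P α)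

namespace Threading

variable {V : Type u} [Quiver.{v} V]

instance (T : Threading.{uP} V) {a b : V} (α : a ⟶ b) : LinearOrder (T.P α) := T.ord α

/-- The objects of the path category: the vertices of the quiver, together with the disjoint union
of all the `P α`. The added minimum (maximum) of `P α` is identified with the source (target)
of `α`. -/
inductive Obj (T : Threading.{uP} V) : Type (max u v uP)
  | vertex (a : V) : Obj T
  | inner {a b : V} (α : a ⟶ b) (x : T.P α) : Obj T

/-- The path-like elements, which form the bases of the Hom spaces of the path category. -/
inductive PathLike (T : Threading.{uP} V) : T.Obj → T.Obj → Type (max u v uP)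
  /-- A path of the quiver, between two vertices; the arrow `α` is `η` from the minimum to the
  maximum of the extension of `P α`. -/
  | path {a b : V} (p : Quiver.Path a b) : PathLike T (.vertex a) (.vertex b)
  /-- A path `p` ending at the source of `β`, followed by `η` from that source to `y`. -/
  | enter {a c d : V} (p : Quiver.Path a c) (β : c ⟶ d) (y : T.P β) :
      PathLike T (.vertex a) (.inner β y)
  /-- `η` from `x` to the target of `α`, followed by a path `p`. -/
  | exit {a b c : V} (α : a ⟶ b) (x : T.P α) (p : Quiver.Path b c) :
      PathLike T (.inner α x) (.vertex c)
  /-- `η` from `x` to `y`, for `x ≤ y` in `P α`; it is the identity when `x = y`. -/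
  | within {a b : V} (α : a ⟶ b) (x y : T.P α) (h : x ≤ y) :
      PathLike T (.inner α x) (.inner α y)
  /-- `η` from `x` to the target of `α`, then a path `p` to the source of `β`, then `η` from that
  source to `y`. -/
  | through {a b c d : V} (α : a ⟶ b) (x : T.P α) (p : Quiver.Path b c) (β : c ⟶ d) (y : T.P β) :
      PathLike T (.inner α x) (.inner β y)

namespace PathLike

variable {T : Threading.{uP} V}

/-- The trivial path at an object. -/
def id : ∀ X : T.Obj, PathLike T X X
  | .vertex _ => .path .nil
  | .inner α x => .within α x x le_rfl

/-- Composition of path-like elements, in diagrammatic order: concatenation, using that `η` from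
`y` to `z` after `η` from `x` to `y` is `η` from `x` to `z`, and that `η` from `x` to the target of
`α` after `η` from the source of `α` to `x` is `α`. -/
def comp : ∀ {X Y Z : T.Obj}, PathLike T X Y → PathLike T Y Z → PathLike T X Z
  | _, _, _, .path p, .path q => .path (p.comp q)
  | _, _, _, .path p, .enter q β y => .enter (p.comp q) β y
  | _, _, _, .enter p β _, .exit _ _ q => .path ((p.cons β).comp q)
  | _, _, _, .enter p β _, .within _ _ z _ => .enter p β z
  | _, _, _, .enter p β _, .through _ _ q γ z => .enter ((p.cons β).comp q) γ z
  | _, _, _, .exit α x p, .path q => .exit α x (p.comp q)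
  | _, _, _, .exit α x p, .enter q β y => .through α x (p.comp q) β y
  | _, _, _, .within α x _ _, .exit _ _ q => .exit α x q
  | _, _, _, .within α x _ h, .within _ _ z h' => .within α x z (h.trans h')
  | _, _, _, .within α x _ _, .through _ _ q β y => .through α x q β y
  | _, _, _, .through α x p β _, .exit _ _ q => .exit α x ((p.cons β).comp q)
  | _, _, _, .through α x p β _, .within _ _ z _ => .through α x p β z
  | _, _, _, .through α x p β _, .through _ _ q γ z => .through α x ((p.cons β).comp q) γ z

end PathLike

/-- The category of path-like elements. -/
instance (T : Threading.{uP} V) : Category.{max u v uP} T.Obj where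
  Hom := PathLike T
  id := PathLike.id
  comp := PathLike.comp
  id_comp f := by cases f <;> simp [PathLike.id, PathLike.comp]
  comp_id f := by cases f <;> simp [PathLike.id, PathLike.comp]
  assoc f g h := by
    cases f <;> cases g <;> cases h <;>
      simp [PathLike.comp, Quiver.Path.comp_assoc, ← Quiver.Path.comp_cons]

/-- The path category of a thread quiver: the `k`-linear category whose Hom spaces have the
path-like elements as bases, with composition extended bilinearly. -/
abbrev PathCategory (k : Type uk) [Field k] (T : Threading.{uP} V) := Free k T.Obj

variable (k : Type uk) [Field k] (T : Threading.{uP} V)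

/-- A functor from the path category to vector spaces is a pointwise finite-dimensional
representation if it is `k`-linear and all its values are finite-dimensional. -/
def isPwfRep : ObjectProperty (PathCategory k T ⥤ ModuleCat.{w} k) := fun M =>
  M.Additive ∧ M.Linear k ∧ ∀ X, Module.Finite k (M.obj X)

/-- The category of pointwise finite-dimensional representations, full in the functor category. -/
abbrev RepPwf := (isPwfRep.{w} k T).FullSubcategory

namespace RepPwf

variable {k T}

/-- `M ≅ X ⊕ Y`, the direct sum being formed pointwise (in the functor category). -/
def IsSum (M X Y : RepPwf.{w} k T) : Prop := Nonempty (M.obj ≅ X.obj ⊞ Y.obj)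

/-- `M` is the direct sum of the possibly infinite family `U`, formed pointwise (in the functor
category). -/
def IsSumOf {ι : Type*} (M : RepPwf.{w} k T) (U : ι → RepPwf.{w} k T) : Prop :=
  ∃ inj : ∀ i, (U i).obj ⟶ M.obj, Nonempty (IsColimit (Cofan.mk M.obj inj))

/-- The support: the set of objects at which the representation does not vanish. -/
def support (M : RepPwf.{w} k T) : Set T.Obj :=
  {X | Nontrivial (M.obj.obj (Free.of k X))}

/-- A representation is noise if its support contains no vertex of the quiver. -/
def IsNoise (M : RepPwf.{w} k T) : Prop :=
  M.support ∩ Set.range Obj.vertex = ∅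

/-- A representation is noise free if it has no nonzero noise direct summand. -/
def IsNoiseFree (M : RepPwf.{w} k T) : Prop :=
  ∀ X Y : RepPwf.{w} k T, IsSum M X Y → X.IsNoise → X.support = ∅

end RepPwf

end Threading

/-! On one thread, a representation is a persistence module with a map in from the source of the
arrow and a map out to its target. Let `I` be the image of the former and `K` the kernel of the
latter. Noise has `K` everything and `I` zero, and morphisms preserve both. So a noise summand is
excluded once `K ≤ I` on every thread (`IsThreadExact`), and the task is to split off the failure of
this inclusion. `exists_isCompl_persistent` does so on each thread by two Zorn arguments, whose
chains are controlled pointwise by finite dimension. It gives complements `C ≥ I` and `N ≤ K` with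
`C ⊓ K ≤ I`. Everything entering the thread lands in `C`, and everything leaving kills `N`. Hence
the pieces `C`, with full spaces at the vertices, and the pieces `N`, with zero there, glue to
complementary subrepresentations, one thread exact and one noise. For uniqueness, a composite noise
→ thread exact → noise vanishes. Comparing two decompositions therefore gives inverse isomorphisms
between the noise parts, and Gaussian elimination gives one between the noise-free parts. Finally,
any path-like element through a vertex acts as zero on noise, so distinct threads do not interact.
-/

section PersistenceModule

/-! ### Splitting persistence modules over a linear order -/

variable {k : Type*} [Field k] {ι : Type*} [LinearOrder ι] {V : ι → Type*}
  [∀ x, AddCommGroup (V x)] [∀ x, Module k (V x)]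

/-- A family of submodules is stable under the structure maps of a persistence module. -/
def IsSubmodulePersistent (f : ∀ x y, x ≤ y → V x →ₗ[k] V y) (S : ∀ x, Submodule k (V x)) : Prop :=
  ∀ x y (h : x ≤ y), (S x).map (f x y h) ≤ S y

/-- In a chain of subspaces of a finite-dimensional space, there is a greatest one among those with
a given property. -/
theorem exists_greatest_of_chain {W : Type*} [AddCommGroup W] [Module k W] [Module.Finite k W]
    {κ : Type*} (F : κ → Submodule k W) (hF : ∀ i j, F i ≤ F j ∨ F j ≤ F i)
    (p : Submodule k W → Prop) (h : ∃ i, p (F i)) :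
    ∃ i, p (F i) ∧ ∀ j, p (F j) → F j ≤ F i := by
  obtain ⟨_, ⟨⟨i, rfl⟩, hi⟩, hmax⟩ := WellFounded.has_min
    (wellFounded_gt (α := Submodule k W)) {U | U ∈ Set.range F ∧ p U}
    (let ⟨i, hi⟩ := h; ⟨F i, ⟨i, rfl⟩, hi⟩)
  refine ⟨i, hi, fun j hj => ?_⟩
  rcases hF j i with hji | hij
  · exact hji
  · by_contra hn
    exact hmax (F j) ⟨⟨j, rfl⟩, hj⟩ (lt_of_le_not_ge hij hn)

/-- In a chain of subspaces of a finite-dimensional space, there is a least one among those with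
a given property. -/
theorem exists_least_of_chain {W : Type*} [AddCommGroup W] [Module k W] [Module.Finite k W]
    {κ : Type*} (F : κ → Submodule k W) (hF : ∀ i j, F i ≤ F j ∨ F j ≤ F i)
    (p : Submodule k W → Prop) (h : ∃ i, p (F i)) :
    ∃ i, p (F i) ∧ ∀ j, p (F j) → F i ≤ F j := by
  obtain ⟨_, ⟨⟨i, rfl⟩, hi⟩, hmin⟩ := WellFounded.has_min
    (wellFounded_lt (α := Submodule k W)) {U | U ∈ Set.range F ∧ p U}
    (let ⟨i, hi⟩ := h; ⟨F i, ⟨i, rfl⟩, hi⟩)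
  refine ⟨i, hi, fun j hj => ?_⟩
  rcases hF i j with hij | hji
  · exact hij
  · by_contra hn
    exact hmin (F j) ⟨⟨j, rfl⟩, hj⟩ (lt_of_le_not_ge hji hn)

variable [∀ x, Module.Finite k (V x)]

/-- If `K` is the kernel of a cocone and `I` the image of a cone, then there is a subobject `C`
containing `I` which is a complement of `K` up to `I`. -/
theorem exists_persistent_complement_of_kernel
    (f : ∀ x y, x ≤ y → V x →ₗ[k] V y)
    (f_id : ∀ x v, f x x le_rfl v = v)
    (f_comp : ∀ x y z (h : x ≤ y) (h' : y ≤ z) v, f y z h' (f x y h v) = f x z (h.trans h') v)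
    (K I : ∀ x, Submodule k (V x))
    (hK : ∀ x y (h : x ≤ y) v, f x y h v ∈ K y ↔ v ∈ K x)
    (hI : ∀ x y (h : x ≤ y), (I x).map (f x y h) = I y) :
    ∃ C, IsSubmodulePersistent f C ∧ (∀ x, I x ≤ C x) ∧ (∀ x, C x ⊔ K x = ⊤) ∧
      ∀ x, C x ⊓ K x ≤ I x := by
  let 𝒮 : Set (∀ x, Submodule k (V x)) :=
    {C | IsSubmodulePersistent f C ∧ (∀ x, I x ≤ C x) ∧ ∀ x, C x ⊔ K x = ⊤}
  have hchain : ∀ c ⊆ 𝒮, IsChain (· ≤ ·) c → ∃ lb ∈ 𝒮, ∀ z ∈ c, lb ≤ z := by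
    intro c hc hch
    rcases c.eq_empty_or_nonempty with rfl | hne
    · exact ⟨fun _ => ⊤, ⟨fun _ _ _ => le_top, fun _ => le_top, fun _ => by simp⟩, by simp⟩
    have hx : ∀ x, ∃ D ∈ c, ∀ E ∈ c, D x ≤ E x := by
      intro x
      have hne' : Nonempty c := hne.to_subtype
      obtain ⟨D, -, hD⟩ := exists_least_of_chain (fun D : c => D.1 x)
        (fun D E => (hch.total D.2 E.2).imp (fun h => h x) (fun h => h x)) (fun _ => True)
        ⟨Classical.arbitrary _, trivial⟩
      exact ⟨D, D.2, fun E hE => hD ⟨E, hE⟩ trivial⟩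
    choose D hDc hD using hx
    -- The pointwise minimum of the chain: by finite dimension it is attained at each `x`, by a
    -- member depending on `x`.
    refine ⟨fun x => D x x, ⟨?_, fun x => (hc (hDc x)).2.1 x, fun x => (hc (hDc x)).2.2 x⟩,
      fun E hE x => hD x E hE⟩
    intro x y h
    exact (Submodule.map_mono (hD x _ (hDc y))).trans ((hc (hDc y)).1 x y h)
  -- Zorn for the reversed order. A minimal `C` that violates the last condition at `x` will be cut
  -- down by one linear functional on `V x`.
  obtain ⟨C, hC⟩ : ∃ C, Minimal (· ∈ 𝒮) C := @zorn_le₀ (∀ x, Submodule k (V x))ᵒᵈ _ 𝒮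
    fun c hc hch => hchain c hc hch.symm
  obtain ⟨hCf, hCI, hCK⟩ := hC.1
  refine ⟨C, hCf, hCI, hCK, fun x => ?_⟩
  by_contra hx
  let F : Set.Iic x → Submodule k (V x) := fun y => (C y).map (f y x y.2)
  have hFmono : ∀ y z : Set.Iic x, y.1 ≤ z.1 → F y ≤ F z := by
    rintro y z h _ ⟨c, hc, rfl⟩
    exact ⟨f y z h c, hCf y z h ⟨c, hc, rfl⟩, f_comp _ _ _ _ _ _⟩
  have hFchain : ∀ y z, F y ≤ F z ∨ F z ≤ F y := fun y z =>
    (le_total y.1 z.1).imp (hFmono y z) (hFmono z y)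
  have hIF : ∀ y, I x ≤ F y := fun y => by
    rw [← hI y x y.2]
    exact Submodule.map_mono (hCI y)
  let p : Submodule k (V x) → Prop := fun U => ∃ l ∈ U, l ∈ K x ∧ l ∉ I x
  have hp : ∃ y, p (F y) := by
    obtain ⟨c, hc, hcI⟩ := SetLike.not_le_iff_exists.1 hx
    exact ⟨⟨x, le_rfl⟩, c, ⟨c, hc.1, f_id x c⟩, hc.2, hcI⟩
  obtain ⟨y₀, ⟨l, hl, hlK, hlI⟩, hy₀⟩ := exists_least_of_chain F hFchain p hp
  -- The images `F y` increase with `y`. By the choice of `y₀`, `l` lies in every `F y` satisfying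
  -- `p`. All the others lie in a single `G` that misses `l`, so some functional kills `G` but not
  -- `l`.
  have hG : ∃ G : Submodule k (V x), l ∉ G ∧ I x ≤ G ∧ ∀ y, ¬ p (F y) → F y ≤ G := by
    by_cases hq : ∃ y, ¬ p (F y)
    · obtain ⟨y₁, hy₁, hmax⟩ := exists_greatest_of_chain F hFchain (fun U => ¬ p U) hq
      exact ⟨F y₁, fun h => hy₁ ⟨l, h, hlK, hlI⟩, hIF y₁, hmax⟩
    · exact ⟨I x, hlI, le_rfl, fun y hy => (hq ⟨y, hy⟩).elim⟩
  obtain ⟨G, hlG, hIG, hG⟩ := hG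
  obtain ⟨φ, hφl, hφ⟩ := G.exists_le_ker_of_notMem hlG
  let C' : ∀ y, Submodule k (V y) := fun y =>
    C y ⊓ ⨅ h : y ≤ x, (LinearMap.ker φ).comap (f y x h)
  have hmem : ∀ y c, c ∈ C' y ↔ c ∈ C y ∧ ∀ h : y ≤ x, φ (f y x h c) = 0 := by
    intro y c
    simp [C', Submodule.mem_iInf]
  have hC' : C' ∈ 𝒮 := by
    refine ⟨?_, ?_, ?_⟩
    · rintro y z h _ ⟨c, hc, rfl⟩
      rw [SetLike.mem_coe, hmem] at hc
      rw [hmem]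
      exact ⟨hCf y z h ⟨c, hc.1, rfl⟩, fun hz => by rw [f_comp]; exact hc.2 _⟩
    · intro y i hi
      rw [hmem]
      refine ⟨hCI y hi, fun h => hφ (hIG ?_)⟩
      rw [← hI y x h]
      exact ⟨i, hi, rfl⟩
    · intro y
      rw [eq_top_iff, ← hCK y]
      refine sup_le (fun c hc => ?_) le_sup_right
      by_cases h : y ≤ x
      · by_cases hpy : p (F ⟨y, h⟩)
        -- A lift `l'` of `l` to `C y` lies in `K y`, so correcting `c` by a multiple of `l'`
        -- reaches the kernel of the functional without changing `c` modulo `K y`.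
        · obtain ⟨l', hl', rfl⟩ := hy₀ ⟨y, h⟩ hpy hl
          let r := φ (f y x h c) / φ (f y x h l')
          have hcr : c - r • l' ∈ C' y := by
            rw [hmem]
            refine ⟨sub_mem hc (Submodule.smul_mem _ _ hl'), fun _ => ?_⟩
            simp [r, hφl]
          rw [← sub_add_cancel c (r • l')]
          exact add_mem (Submodule.mem_sup_left hcr)
            (Submodule.mem_sup_right (Submodule.smul_mem _ _ ((hK y x h l').1 hlK)))
        · exact Submodule.mem_sup_left
            ((hmem y c).2 ⟨hc, fun _ => hφ (hG ⟨y, h⟩ hpy ⟨c, hc, rfl⟩)⟩)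
      · exact Submodule.mem_sup_left ((hmem y c).2 ⟨hc, fun h' => (h h').elim⟩)
  have hle : C ≤ C' := hC.2 hC' (show C' ≤ C from fun y => inf_le_left)
  have hlC : l ∈ C x := by
    obtain ⟨c, hc, rfl⟩ := hl
    exact hCf _ _ _ ⟨c, hc, rfl⟩
  have := ((hmem x l).1 (hle x hlC)).2 le_rfl
  rw [f_id] at this
  exact hφl this

/-- If `K` is the kernel of a cocone and `I` the image of a cone, then there is a subobject `N`
of `K` which is a complement of `K ⊓ I` in `K`. -/
theorem exists_persistent_complement_of_image
    (f : ∀ x y, x ≤ y → V x →ₗ[k] V y)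
    (f_id : ∀ x v, f x x le_rfl v = v)
    (f_comp : ∀ x y z (h : x ≤ y) (h' : y ≤ z) v, f y z h' (f x y h v) = f x z (h.trans h') v)
    (K I : ∀ x, Submodule k (V x))
    (hK : ∀ x y (h : x ≤ y) v, f x y h v ∈ K y ↔ v ∈ K x)
    (hI : ∀ x y (h : x ≤ y), (I x).map (f x y h) = I y) :
    ∃ N, IsSubmodulePersistent f N ∧ (∀ x, N x ≤ K x) ∧ (∀ x, N x ⊓ I x = ⊥) ∧
      ∀ x, K x ≤ N x ⊔ I x := by
  let 𝒮 : Set (∀ x, Submodule k (V x)) :=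
    {N | IsSubmodulePersistent f N ∧ (∀ x, N x ≤ K x) ∧ ∀ x, N x ⊓ I x = ⊥}
  have hchain : ∀ c ⊆ 𝒮, IsChain (· ≤ ·) c → ∃ ub ∈ 𝒮, ∀ z ∈ c, z ≤ ub := by
    intro c hc hch
    rcases c.eq_empty_or_nonempty with rfl | hne
    · exact ⟨fun _ => ⊥, ⟨fun _ _ _ => by simp, fun _ => bot_le, fun _ => by simp⟩, by simp⟩
    have hx : ∀ x, ∃ D ∈ c, ∀ E ∈ c, E x ≤ D x := by
      intro x
      have hne' : Nonempty c := hne.to_subtype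
      obtain ⟨D, -, hD⟩ := exists_greatest_of_chain (fun D : c => D.1 x)
        (fun D E => (hch.total D.2 E.2).imp (fun h => h x) (fun h => h x)) (fun _ => True)
        ⟨Classical.arbitrary _, trivial⟩
      exact ⟨D, D.2, fun E hE => hD ⟨E, hE⟩ trivial⟩
    choose D hDc hD using hx
    refine ⟨fun x => D x x, ⟨?_, fun x => (hc (hDc x)).2.1 x, fun x => (hc (hDc x)).2.2 x⟩,
      fun E hE x => hD x E hE⟩
    intro x y h
    exact ((hc (hDc x)).1 x y h).trans (hD y _ (hDc x))
  obtain ⟨N, hN⟩ := zorn_le₀ 𝒮 hchain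
  obtain ⟨hNf, hNK, hNI⟩ := hN.1
  refine ⟨N, hNf, hNK, hNI, fun x => ?_⟩
  by_contra hx
  -- Dual to the previous argument: preimages from later points replace images from earlier ones,
  -- and a maximal `N` will be enlarged by the orbit of one vector.
  let F : Set.Ici x → Submodule k (V x) := fun y => (N y).comap (f x y y.2)
  have hFmono : ∀ y z : Set.Ici x, y.1 ≤ z.1 → F y ≤ F z := by
    intro y z h v hv
    have := hNf y z h ⟨_, hv, rfl⟩
    rwa [f_comp x y z y.2 h v] at this
  have hFchain : ∀ y z, F y ≤ F z ∨ F z ≤ F y := fun y z =>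
    (le_total y.1 z.1).imp (hFmono y z) (hFmono z y)
  have hFx : F ⟨x, le_rfl⟩ = N x := by
    ext v
    simp [F, f_id]
  let p : Submodule k (V x) → Prop := fun U => K x ≤ U ⊔ I x
  have hp : ∃ y, ¬ p (F y) := ⟨⟨x, le_rfl⟩, by simpa only [p, hFx] using hx⟩
  obtain ⟨y₁, hy₁, hmax⟩ := exists_greatest_of_chain F hFchain (fun U => ¬ p U) hp
  have hG : ∃ G : Submodule k (V x), G ≤ K x ∧ p G ∧ ∀ y, p (F y) → G ≤ F y := by
    by_cases hq : ∃ y, p (F y)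
    · obtain ⟨y₀, hy₀, hmin⟩ := exists_least_of_chain F hFchain p hq
      exact ⟨F y₀, fun v hv => (hK x y₀ y₀.2 v).1 (hNK _ hv), hy₀, hmin⟩
    · exact ⟨K x, le_rfl, le_sup_left, fun y hy => (hq ⟨y, hy⟩).elim⟩
  obtain ⟨G, hGK, hpG, hG⟩ := hG
  obtain ⟨v, hvG, hv⟩ : ∃ v ∈ G, v ∉ F y₁ ⊔ I x :=
    SetLike.not_le_iff_exists.1 fun h => hy₁ (hpG.trans (sup_le h le_sup_right))
  -- The orbit of `v` meets `N y ⊔ I y` only once it is already in `N y`. Otherwise, lifting the `I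
  -- y` part back to `I x` would put `v` in `F y₁ ⊔ I x`.
  have key : ∀ y (h : x ≤ y), f x y h v ∈ N y ⊔ I y → f x y h v ∈ N y := by
    intro y h hvy
    by_cases hpy : p (F ⟨y, h⟩)
    · exact hG _ hpy hvG
    · obtain ⟨n, hn, i, hi, hni⟩ := Submodule.mem_sup.1 hvy
      rw [← hI x y h] at hi
      obtain ⟨i, hi, rfl⟩ := hi
      refine (hv ?_).elim
      rw [← sub_add_cancel v i]
      refine add_mem (Submodule.mem_sup_left (hmax _ hpy ?_)) (Submodule.mem_sup_right hi)
      change f x y h (v - i) ∈ N y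
      rwa [map_sub, ← hni, add_sub_cancel_right]
  let N' : ∀ y, Submodule k (V y) := fun y => N y ⊔ ⨆ h : x ≤ y, k ∙ f x y h v
  have hN'pos : ∀ y (h : x ≤ y), N' y = N y ⊔ k ∙ f x y h v := fun y h => by simp [N', h]
  have hN'neg : ∀ y, ¬ x ≤ y → N' y = N y := fun y h => by simp [N', h]
  have hN' : N' ∈ 𝒮 := by
    refine ⟨?_, ?_, ?_⟩
    · intro y z h
      by_cases hy : x ≤ y
      · rw [hN'pos y hy, hN'pos z (hy.trans h), Submodule.map_sup, Submodule.map_span,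
          Set.image_singleton, f_comp]
        exact sup_le_sup_right (hNf y z h) _
      · rw [hN'neg y hy]
        exact (hNf y z h).trans le_sup_left
    · intro y
      refine sup_le (hNK y) (iSup_le fun h => ?_)
      rw [Submodule.span_singleton_le_iff_mem, hK]
      exact hGK hvG
    · intro y
      by_cases hy : x ≤ y
      · rw [hN'pos y hy, eq_bot_iff, ← hNI y]
        rintro u ⟨hu, huI⟩
        refine ⟨?_, huI⟩
        obtain ⟨n, hn, w, hw, rfl⟩ := Submodule.mem_sup.1 hu
        obtain ⟨a, rfl⟩ := Submodule.mem_span_singleton.1 hw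
        rcases eq_or_ne a 0 with rfl | ha
        · simpa using hn
        · refine add_mem hn (Submodule.smul_mem _ _ (key y hy ?_))
          have : f x y hy v = a⁻¹ • ((n + a • f x y hy v) - n) := by
            rw [add_sub_cancel_left, inv_smul_smul₀ ha]
          rw [this]
          exact Submodule.smul_mem _ _ (sub_mem (Submodule.mem_sup_right huI)
            (Submodule.mem_sup_left hn))
      · rw [hN'neg y hy]
        exact hNI y
  have hle : N' ≤ N := hN.2 hN' fun y => le_sup_left
  have hvN : v ∈ N x := by
    have := hle x
    rw [hN'pos x le_rfl, f_id] at this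
    exact this (Submodule.mem_sup_right (Submodule.mem_span_singleton_self v))
  refine hv (Submodule.mem_sup_left (hmax ⟨x, le_rfl⟩ ?_ ?_))
  · simpa only [p, hFx] using hx
  · rwa [hFx]

/-- If `K` is the kernel of a cocone and `I` the image of a cone, then a pointwise
finite-dimensional persistence module is a direct sum of subobjects `N` and `C`, with `N` inside
`K` and `C` containing `I` and meeting `K` in a subspace of `I`. -/
theorem exists_isCompl_persistent
    (f : ∀ x y, x ≤ y → V x →ₗ[k] V y)
    (f_id : ∀ x v, f x x le_rfl v = v)
    (f_comp : ∀ x y z (h : x ≤ y) (h' : y ≤ z) v, f y z h' (f x y h v) = f x z (h.trans h') v)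
    (K I : ∀ x, Submodule k (V x))
    (hK : ∀ x y (h : x ≤ y) v, f x y h v ∈ K y ↔ v ∈ K x)
    (hI : ∀ x y (h : x ≤ y), (I x).map (f x y h) = I y) :
    ∃ C N, IsSubmodulePersistent f C ∧ IsSubmodulePersistent f N ∧ (∀ x, IsCompl (C x) (N x)) ∧
      (∀ x, I x ≤ C x) ∧ (∀ x, N x ≤ K x) ∧ ∀ x, C x ⊓ K x ≤ I x := by
  obtain ⟨C, hC, hIC, hCK, hCKI⟩ := exists_persistent_complement_of_kernel f f_id f_comp K I hK hI
  obtain ⟨N, hN, hNK, hNI, hKN⟩ := exists_persistent_complement_of_image f f_id f_comp K I hK hI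
  -- The independently chosen `C` and `N` are complementary: `C ⊓ N ≤ I ⊓ N = ⊥`, and `C ⊔ N`
  -- contains `I` and `N`, hence `K`, hence everything.
  refine ⟨C, N, hC, hN, fun x => ⟨?_, ?_⟩, hIC, hNK, hCKI⟩
  · rw [disjoint_iff, eq_bot_iff, ← hNI x]
    exact fun v hv => ⟨hv.2, hCKI x ⟨hv.1, hNK x hv.2⟩⟩
  · rw [codisjoint_iff, eq_top_iff, ← hCK x]
    exact sup_le le_sup_left ((hKN x).trans (sup_le le_sup_right ((hIC x).trans le_sup_left)))

end PersistenceModule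

/-! ### Action of path-like elements on representations -/

namespace Threading

namespace RepPwf

variable {V : Type u} [Quiver.{v} V] {k : Type uk} [Field k] {T : Threading.{uP} V}

instance (M : RepPwf.{w} k T) : M.obj.Additive := M.property.1

instance (M : RepPwf.{w} k T) : M.obj.Linear k := M.property.2.1

instance (M : RepPwf.{w} k T) (X : PathCategory k T) : Module.Finite k (M.obj.obj X) :=
  M.property.2.2 X

/-- The action of a path-like element on a representation. -/
noncomputable def act (M : RepPwf.{w} k T) {X Y : T.Obj} (f : X ⟶ Y) :
    M.obj.obj (Free.of k X) →ₗ[k] M.obj.obj (Free.of k Y) :=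
  (M.obj.map ((Free.embedding k T.Obj).map f)).hom

theorem act_id (M : RepPwf.{w} k T) (X : T.Obj) (v : M.obj.obj (Free.of k X)) :
    M.act (𝟙 X) v = v :=
  congrArg (fun g => g.hom v) (M.obj.map_id (Free.of k X))

theorem act_act (M : RepPwf.{w} k T) {X Y Z : T.Obj} (f : X ⟶ Y) (g : Y ⟶ Z)
    (v : M.obj.obj (Free.of k X)) : M.act g (M.act f v) = M.act (f ≫ g) v := by
  simp only [act, Functor.map_comp]
  rfl

theorem app_act {M N : RepPwf.{w} k T} (φ : M.obj ⟶ N.obj) {X Y : T.Obj} (f : X ⟶ Y)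
    (v : M.obj.obj (Free.of k X)) :
    (φ.app (Free.of k Y)).hom (M.act f v) = N.act f ((φ.app (Free.of k X)).hom v) :=
  congrArg (fun g => g.hom v) (φ.naturality ((Free.embedding k T.Obj).map f))

/-- The image of any vector under any morphism of the path category is a linear combination of
its images under path-like elements. -/
theorem map_mem (M : RepPwf.{w} k T) {X Y : T.Obj} {v : M.obj.obj (Free.of k X)}
    {U : Submodule k (M.obj.obj (Free.of k Y))} (h : ∀ f : X ⟶ Y, M.act f v ∈ U)
    (g : Free.of k X ⟶ Free.of k Y) : (M.obj.map g).hom v ∈ U := by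
  induction g using Finsupp.induction_linear with
  | zero =>
    have : M.obj.map (0 : Free.of k X ⟶ Free.of k Y) = 0 := M.obj.map_zero _ _
    erw [this]
    exact U.zero_mem
  | add g₁ g₂ h₁ h₂ =>
    have : M.obj.map ((g₁ : Free.of k X ⟶ Free.of k Y) + g₂) = M.obj.map g₁ + M.obj.map g₂ :=
      M.obj.map_add
    erw [this]
    exact U.add_mem h₁ h₂
  | single f r =>
    have : M.obj.map (r • (Free.embedding k T.Obj).map f) =
      r • M.obj.map ((Free.embedding k T.Obj).map f) := M.obj.map_smul _ _
    rw [← Finsupp.smul_single_one]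
    erw [this]
    exact U.smul_mem r (h f)

/-- Reduces stability of a family of subspaces to the basis of path-like elements. -/
theorem map_mem_of_act_mem (M : RepPwf.{w} k T)
    (S : ∀ X : PathCategory k T, Submodule k (M.obj.obj X))
    (hS : ∀ ⦃X Y : T.Obj⦄ (f : X ⟶ Y), ∀ v ∈ S (Free.of k X), M.act f v ∈ S (Free.of k Y))
    ⦃X Y : PathCategory k T⦄ (g : X ⟶ Y) : ∀ v ∈ S X, (M.obj.map g).hom v ∈ S Y :=
  fun v hv => M.map_mem (X := X) (Y := Y) (fun f => hS f v hv) g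

theorem projectionOnto_add {E : Type*} [AddCommGroup E] [Module k E] {p q : Submodule k E}
    (h : IsCompl p q) {a b : E} (ha : a ∈ p) (hb : b ∈ q) :
    p.projectionOnto q h (a + b) = ⟨a, ha⟩ := by
  rw [map_add, Submodule.projectionOnto_apply_left h ⟨a, ha⟩,
    Submodule.projectionOnto_apply_right h ⟨b, hb⟩, add_zero]

/-! ### Subrepresentations and pointwise complements -/

section Sub

variable (M : RepPwf.{w} k T) (S : ∀ X : PathCategory k T, Submodule k (M.obj.obj X))
  (hS : ∀ ⦃X Y : PathCategory k T⦄ (g : X ⟶ Y), ∀ v ∈ S X, (M.obj.map g).hom v ∈ S Y)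

/-- The subrepresentation given by a stable family of subspaces. -/
def sub : RepPwf.{w} k T where
  obj :=
    { obj := fun X => ModuleCat.of k (S X)
      map := fun g => ModuleCat.ofHom ((M.obj.map g).hom.restrict (hS g))
      map_id := fun X => by
        ext v
        exact (congrArg (fun h => h.hom v.1) (M.obj.map_id X))
      map_comp := fun f g => by
        ext v
        exact (congrArg (fun h => h.hom v.1) (M.obj.map_comp f g)) }
  property := by
    refine ⟨⟨?_⟩, ⟨?_⟩, fun X => ?_⟩
    · intro X Y f g
      ext v
      exact congrArg (fun h => h.hom v.1) (M.obj.map_add (f := f) (g := g))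
    · intro X Y f r
      ext v
      exact congrArg (fun h => h.hom v.1) (M.obj.map_smul r f)
    · change Module.Finite k (S X)
      infer_instance

/-- The inclusion of a subrepresentation. -/
def subι : (M.sub S hS).obj ⟶ M.obj where
  app X := ModuleCat.ofHom (S X).subtype
  naturality _ _ _ := rfl

/-- The projection to a subrepresentation along a complementary subrepresentation. -/
noncomputable def subπ (S' : ∀ X : PathCategory k T, Submodule k (M.obj.obj X))
    (hS' : ∀ ⦃X Y : PathCategory k T⦄ (g : X ⟶ Y), ∀ v ∈ S' X, (M.obj.map g).hom v ∈ S' Y)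
    (h : ∀ X, IsCompl (S X) (S' X)) : M.obj ⟶ (M.sub S hS).obj where
  app X := ModuleCat.ofHom ((S X).projectionOnto (S' X) (h X))
  naturality X Y g := by
    ext v
    obtain ⟨a, ha, b, hb, rfl⟩ := Submodule.mem_sup.1
      ((h X).sup_eq_top.symm ▸ Submodule.mem_top : (v : M.obj.obj X) ∈ S X ⊔ S' X)
    have hga : (M.obj.map g).hom a ∈ S Y := hS g a ha
    have hgb : (M.obj.map g).hom b ∈ S' Y := hS' g b hb
    change (S Y).projectionOnto (S' Y) (h Y) ((M.obj.map g).hom (a + b)) =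
      ((M.sub S hS).obj.map g).hom ((S X).projectionOnto (S' X) (h X) (a + b))
    rw [map_add, projectionOnto_add _ hga hgb, projectionOnto_add _ ha hb]
    rfl

theorem isSum_sub (S' : ∀ X : PathCategory k T, Submodule k (M.obj.obj X))
    (hS' : ∀ ⦃X Y : PathCategory k T⦄ (g : X ⟶ Y), ∀ v ∈ S' X, (M.obj.map g).hom v ∈ S' Y)
    (h : ∀ X, IsCompl (S X) (S' X)) : M.IsSum (M.sub S hS) (M.sub S' hS') := by
  let b : BinaryBicone (M.sub S hS).obj (M.sub S' hS').obj :=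
    { pt := M.obj
      fst := M.subπ S hS S' hS' h
      snd := M.subπ S' hS' S hS fun X => (h X).symm
      inl := M.subι S hS
      inr := M.subι S' hS'
      inl_fst := by
        ext X v
        exact Submodule.projectionOnto_apply_left (h X) v
      inl_snd := by
        ext X v
        exact Submodule.projectionOnto_apply_right (h X).symm v
      inr_fst := by
        ext X v
        exact Submodule.projectionOnto_apply_right (h X) v
      inr_snd := by
        ext X v
        exact Submodule.projectionOnto_apply_left (h X).symm v }
  have hb : b.IsBilimit := isBinaryBilimitOfTotal b (by
    ext X v
    obtain ⟨a, ha, c, hc, rfl⟩ := Submodule.mem_sup.1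
      ((h X).sup_eq_top.symm ▸ Submodule.mem_top : (v : M.obj.obj X) ∈ S X ⊔ S' X)
    change ((S X).projectionOnto (S' X) (h X) (a + c)).1 +
      ((S' X).projectionOnto (S X) (h X).symm (a + c)).1 = a + c
    rw [projectionOnto_add _ ha hc, add_comm a c, projectionOnto_add _ hc ha, add_comm])
  exact ⟨biprod.uniqueUpToIso _ _ hb⟩

end Sub

/-! ### Thread exactness, existence and uniqueness -/

section Thread

/-- The vectors at a point of a thread that vanish at the end of the thread. -/
noncomputable def exitKer (M : RepPwf.{w} k T) {a b : V} (α : a ⟶ b) (x : T.P α) :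
    Submodule k (M.obj.obj (Free.of k (.inner α x))) :=
  LinearMap.ker (M.act (PathLike.exit α x .nil : Obj.inner α x ⟶ Obj.vertex b))

/-- The vectors at a point of a thread that come from the start of the thread. -/
noncomputable def enterRange (M : RepPwf.{w} k T) {a b : V} (α : a ⟶ b) (x : T.P α) :
    Submodule k (M.obj.obj (Free.of k (.inner α x))) :=
  LinearMap.range (M.act (PathLike.enter .nil α x : Obj.vertex a ⟶ Obj.inner α x))

/-- On every thread, a vector that vanishes at the end of the thread comes from its start. -/
def IsThreadExact (M : RepPwf.{w} k T) : Prop :=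
  ∀ ⦃a b : V⦄ (α : a ⟶ b) (x : T.P α), M.exitKer α x ≤ M.enterRange α x

theorem isNoise_iff (M : RepPwf.{w} k T) :
    M.IsNoise ↔ ∀ a, Subsingleton (M.obj.obj (Free.of k (Obj.vertex (T := T) a))) := by
  simp only [IsNoise, Set.eq_empty_iff_forall_notMem, Set.mem_inter_iff, Set.mem_range, support,
    Set.mem_ofPred_eq, not_and, not_exists]
  constructor
  · intro h a
    rw [← not_nontrivial_iff_subsingleton]
    exact fun hn => h _ hn a rfl
  · rintro h _ hn a rfl
    exact not_nontrivial_iff_subsingleton.2 (h a) hn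

theorem support_eq_empty_iff (M : RepPwf.{w} k T) :
    M.support = ∅ ↔ ∀ X, Subsingleton (M.obj.obj (Free.of k X)) := by
  simp [support, Set.eq_empty_iff_forall_notMem, not_nontrivial_iff_subsingleton]

theorem app_mem_exitKer {M N : RepPwf.{w} k T} (φ : M.obj ⟶ N.obj) {a b : V} {α : a ⟶ b}
    {x : T.P α} {v : M.obj.obj (Free.of k (.inner α x))} (hv : v ∈ M.exitKer α x) :
    (φ.app _).hom v ∈ N.exitKer α x := by
  rw [exitKer, LinearMap.mem_ker] at hv ⊢
  rw [← app_act, hv, map_zero]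

theorem app_mem_enterRange {M N : RepPwf.{w} k T} (φ : M.obj ⟶ N.obj) {a b : V} {α : a ⟶ b}
    {x : T.P α} {v : M.obj.obj (Free.of k (.inner α x))} (hv : v ∈ M.enterRange α x) :
    (φ.app _).hom v ∈ N.enterRange α x := by
  obtain ⟨u, rfl⟩ := hv
  exact ⟨_, (app_act φ _ u).symm⟩

theorem IsNoise.mem_exitKer {M : RepPwf.{w} k T} (hM : M.IsNoise) {a b : V} {α : a ⟶ b}
    {x : T.P α} (v : M.obj.obj (Free.of k (.inner α x))) : v ∈ M.exitKer α x :=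
  have := M.isNoise_iff.1 hM b
  Subsingleton.elim _ _

theorem IsNoise.eq_zero_of_mem_enterRange {M : RepPwf.{w} k T} (hM : M.IsNoise) {a b : V}
    {α : a ⟶ b} {x : T.P α} {v : M.obj.obj (Free.of k (.inner α x))}
    (hv : v ∈ M.enterRange α x) : v = 0 := by
  obtain ⟨u, rfl⟩ := hv
  have := M.isNoise_iff.1 hM a
  rw [Subsingleton.elim u 0, map_zero]

theorem IsSum.symm {M X Y : RepPwf.{w} k T} (h : M.IsSum X Y) : M.IsSum Y X :=
  h.map fun e => e ≪≫ biprod.braiding _ _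

/-- A vector of a noise summand dies at the end of its thread, so in `M` it comes from the start.
Projecting back, it comes from the start within the summand, where the source carries zero. -/
theorem IsThreadExact.isNoiseFree {M : RepPwf.{w} k T} (hM : M.IsThreadExact) :
    M.IsNoiseFree := by
  rintro X Y ⟨e⟩ hX
  rw [support_eq_empty_iff]
  rintro (a | ⟨α, x⟩)
  · exact X.isNoise_iff.1 hX a
  refine ⟨fun v w => ?_⟩
  rw [← sub_eq_zero]
  have hv : ∀ v, ((e.hom ≫ biprod.fst).app _).hom (((biprod.inl ≫ e.inv).app _).hom v) = v :=
    fun v => congrArg (fun g => (g.app (Free.of k (.inner α x))).hom v)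
      (show (biprod.inl ≫ e.inv) ≫ e.hom ≫ biprod.fst = 𝟙 X.obj by simp)
  rw [← hv (v - w)]
  exact hX.eq_zero_of_mem_enterRange (app_mem_enterRange (M := M) (N := X) _
    (hM α x (app_mem_exitKer (M := X) (N := M) _ (hX.mem_exitKer _))))

/-- A family of subspaces at the vertices and along the threads. -/
def glue (M : RepPwf.{w} k T)
    (B : ∀ a : V, Submodule k (M.obj.obj (Free.of k (Obj.vertex (T := T) a))))
    (C : ∀ (a b : V) (α : a ⟶ b) (x : T.P α), Submodule k (M.obj.obj (Free.of k (.inner α x)))) :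
    ∀ X : T.Obj, Submodule k (M.obj.obj (Free.of k X))
  | .vertex a => B a
  | .inner α x => C _ _ α x

theorem exists_isSum_isThreadExact_isNoise (M : RepPwf.{w} k T) :
    ∃ C N : RepPwf.{w} k T, M.IsSum C N ∧ C.IsThreadExact ∧ N.IsNoise := by
  -- Leaving from `x` factors through any later `y`, so the kernels are preimages of one another.
  -- Dually, entering at `y` factors through any earlier `x`, so the ranges are images of one
  -- another.
  have key : ∀ (a b : V) (α : a ⟶ b), _ := fun a b α =>
    exists_isCompl_persistent (k := k) (ι := T.P α)
      (V := fun x => M.obj.obj (Free.of k (.inner α x)))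
      (fun x y h => M.act (PathLike.within α x y h : Obj.inner α x ⟶ Obj.inner α y))
      (fun x v => M.act_id _ v) (fun x y z h h' v => M.act_act _ _ v)
      (fun x => M.exitKer α x) (fun x => M.enterRange α x)
      (fun x y h v => by
        simp only [exitKer, LinearMap.mem_ker, act_act]
        rfl)
      (fun x y h => by
        simp only [enterRange, LinearMap.range_eq_map, ← Submodule.map_comp]
        congr 1
        ext v
        exact M.act_act _ _ v)
  choose C N hC hN hCN hIC hNK hCK using key
  let SC := M.glue (fun _ => ⊤) C
  let SN := M.glue (fun _ => ⊥) N
  have hSC : ∀ ⦃X Y : T.Obj⦄ (f : X ⟶ Y), ∀ v ∈ SC X, M.act f v ∈ SC Y := by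
    rintro X Y (f : PathLike T X Y) v hv
    cases f with
    | path p => exact Submodule.mem_top
    | enter p β y =>
      exact hIC _ _ β y ⟨M.act (PathLike.path p : Obj.vertex _ ⟶ Obj.vertex _) v, M.act_act _ _ v⟩
    | exit α x p => exact Submodule.mem_top
    | within α x y h => exact hC _ _ α x y h ⟨v, hv, rfl⟩
    | through α x p β y =>
      exact hIC _ _ β y ⟨M.act (PathLike.exit α x p : Obj.inner _ _ ⟶ Obj.vertex _) v,
        M.act_act _ _ v⟩
  have hSN : ∀ ⦃X Y : T.Obj⦄ (f : X ⟶ Y), ∀ v ∈ SN X, M.act f v ∈ SN Y := by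
    rintro X Y (f : PathLike T X Y) v hv
    -- Every path-like element that leaves the thread starts with the exit map, which kills `N`.
    have hzero : ∀ {a b : V} (α : a ⟶ b) (x : T.P α) (Y : T.Obj)
        (g : (Obj.vertex b : T.Obj) ⟶ Y), ∀ v ∈ N a b α x,
        M.act ((PathLike.exit α x .nil : Obj.inner α x ⟶ Obj.vertex b) ≫ g) v = 0 := by
      intro a b α x Y g v hv
      rw [← M.act_act, show M.act _ v = 0 from hNK a b α x hv, map_zero]
    cases f with
    | path p =>
      obtain rfl : v = 0 := hv
      rw [map_zero]
      exact Submodule.zero_mem _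
    | enter p β y =>
      obtain rfl : v = 0 := hv
      rw [map_zero]
      exact Submodule.zero_mem _
    | exit α x p =>
      have := hzero α x _ (PathLike.path p : Obj.vertex _ ⟶ Obj.vertex _) v hv
      simp only [CategoryStruct.comp, PathLike.comp, Quiver.Path.nil_comp] at this
      exact this.symm ▸ Submodule.zero_mem _
    | within α x y h => exact hN _ _ α x y h ⟨v, hv, rfl⟩
    | through α x p β y =>
      have := hzero α x _ (PathLike.enter p β y : Obj.vertex _ ⟶ Obj.inner _ _) v hv
      simp only [CategoryStruct.comp, PathLike.comp, Quiver.Path.nil_comp] at this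
      exact this.symm ▸ Submodule.zero_mem _
  have hSC' := M.map_mem_of_act_mem SC hSC
  have hSN' := M.map_mem_of_act_mem SN hSN
  refine ⟨M.sub SC hSC', M.sub SN hSN', M.isSum_sub SC hSC' SN hSN' ?_, ?_, ?_⟩
  · rintro (a | ⟨α, x⟩)
    · exact isCompl_top_bot
    · exact hCN _ _ α x
  · intro a b α x v hv
    obtain ⟨u, hu⟩ := hCK a b α x ⟨v.2, app_mem_exitKer (M.subι SC hSC') hv⟩
    exact ⟨⟨u, Submodule.mem_top⟩, Subtype.ext hu⟩
  · rw [isNoise_iff]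
    intro a
    exact Unique.instSubsingleton (α := (⊥ : Submodule k (M.obj.obj (Free.of k _))))

/-- The noise part of the constructed decomposition must vanish, so every vector comes from the
thread exact part, and exactness transfers. -/
theorem IsNoiseFree.isThreadExact {M : RepPwf.{w} k T} (hM : M.IsNoiseFree) :
    M.IsThreadExact := by
  obtain ⟨C, N, h, hC, hN⟩ := M.exists_isSum_isThreadExact_isNoise
  have hN0 := N.support_eq_empty_iff.1 (hM N C h.symm hN)
  obtain ⟨e⟩ := h
  intro a b α x v hv
  have := hN0 (.inner α x)
  have hv' : v = ((biprod.inl ≫ e.inv).app _).hom (((e.hom ≫ biprod.fst).app _).hom v) +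
      ((biprod.inr ≫ e.inv).app _).hom (((e.hom ≫ biprod.snd).app _).hom v) :=
    congrArg (fun g => (g.app (Free.of k (.inner α x))).hom v)
      (show 𝟙 M.obj = (e.hom ≫ biprod.fst) ≫ biprod.inl ≫ e.inv +
        (e.hom ≫ biprod.snd) ≫ biprod.inr ≫ e.inv by
          simp only [Category.assoc, ← Preadditive.comp_add]
          simp only [← Category.assoc, ← Preadditive.add_comp]
          simp [biprod.total])
  rw [Subsingleton.elim (((e.hom ≫ biprod.snd).app _).hom v) 0, map_zero, add_zero] at hv'
  rw [hv']
  exact app_mem_enterRange (M := C) (N := M) _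
    (hC α x (app_mem_exitKer (M := M) (N := C) _ hv))

/-- The noise summands of two decompositions of a representation are isomorphic through the
representation. -/
theorem noise_comp_noise_eq_id {M X Y X' Y' : RepPwf.{w} k T} (e : M.obj ≅ X.obj ⊞ Y.obj)
    (e' : M.obj ≅ X'.obj ⊞ Y'.obj) (hY : Y.IsNoise) (hX' : X'.IsThreadExact) :
    (biprod.inr ≫ e.inv ≫ e'.hom ≫ biprod.snd) ≫ biprod.inr ≫ e'.inv ≫ e.hom ≫ biprod.snd =
      𝟙 Y.obj := by
  -- Vectors of noise `Y` land in `exitKer` of `X'`, hence in its `enterRange`, which maps to zero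
  -- in `Y`. So in the expansion of the identity of `Y` through `X' ⊞ Y'`, only the `Y'` term
  -- survives.
  have hzero : (biprod.inr ≫ e.inv ≫ e'.hom ≫ biprod.fst) ≫
      biprod.inl ≫ e'.inv ≫ e.hom ≫ biprod.snd = (0 : Y.obj ⟶ Y.obj) := by
    ext Z v
    rcases (Z : T.Obj) with a | ⟨α, x⟩
    · exact (Y.isNoise_iff.1 hY a).elim _ _
    · exact hY.eq_zero_of_mem_enterRange (app_mem_enterRange (M := X') (N := Y)
        (biprod.inl ≫ e'.inv ≫ e.hom ≫ biprod.snd) (hX' α x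
        (app_mem_exitKer (M := Y) (N := X') (biprod.inr ≫ e.inv ≫ e'.hom ≫ biprod.fst)
          (hY.mem_exitKer _))))
  have htotal : (biprod.inr ≫ e.inv ≫ e'.hom) ≫
      (biprod.fst ≫ biprod.inl + biprod.snd ≫ biprod.inr) ≫ e'.inv ≫ e.hom ≫ biprod.snd =
      𝟙 Y.obj := by
    rw [biprod.total]
    simp
  rw [← htotal, ← zero_add (_ ≫ _), ← hzero]
  simp only [Preadditive.add_comp, Preadditive.comp_add, Category.assoc]

theorem nonempty_iso_of_isSum {M X Y X' Y' : RepPwf.{w} k T} (h : M.IsSum X Y)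
    (hX : X.IsNoiseFree) (hY : Y.IsNoise) (h' : M.IsSum X' Y') (hX' : X'.IsNoiseFree)
    (hY' : Y'.IsNoise) : Nonempty (X ≅ X') ∧ Nonempty (Y ≅ Y') := by
  obtain ⟨e⟩ := h
  obtain ⟨e'⟩ := h'
  let i : Y.obj ≅ Y'.obj :=
    { hom := biprod.inr ≫ e.inv ≫ e'.hom ≫ biprod.snd
      inv := biprod.inr ≫ e'.inv ≫ e.hom ≫ biprod.snd
      hom_inv_id := noise_comp_noise_eq_id e e' hY hX'.isThreadExact
      inv_hom_id := noise_comp_noise_eq_id e' e hY' hX.isThreadExact }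
  -- The noise summand goes first because `Biprod.isoElim` cancels the first summands when the
  -- component between them is an isomorphism.
  let f : Y.obj ⊞ X.obj ≅ Y'.obj ⊞ X'.obj :=
    biprod.braiding _ _ ≪≫ e.symm ≪≫ e' ≪≫ biprod.braiding _ _
  have hf : biprod.inl ≫ f.hom ≫ biprod.fst = i.hom := by
    have hb : biprod.inl ≫ (biprod.braiding Y.obj X.obj).hom = biprod.inr :=
      biprod.hom_ext _ _ (by simp) (by simp)
    have hb' : (biprod.braiding X'.obj Y'.obj).hom ≫ biprod.fst = biprod.snd := by simp
    simp only [f, i, Iso.trans_hom, Iso.symm_hom, Category.assoc, hb', reassoc_of% hb]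
  have : IsIso (biprod.inl ≫ f.hom ≫ biprod.fst) := hf ▸ i.isIso_hom
  exact ⟨⟨ObjectProperty.isoMk _ (Biprod.isoElim f)⟩, ⟨ObjectProperty.isoMk _ i⟩⟩

end Thread

/-! ### Splitting noise over the arrows -/

section Arrows

open Classical in
/-- The full subspaces along the thread of `α`, and zero elsewhere. -/
noncomputable def threadPart (M : RepPwf.{w} k T) (α : Quiver.Total V) :
    ∀ X : T.Obj, Submodule k (M.obj.obj (Free.of k X)) :=
  M.glue (fun _ => ⊥) fun a b β _ => if (⟨a, b, β⟩ : Quiver.Total V) = α then ⊤ else ⊥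

theorem mem_threadPart_inner (M : RepPwf.{w} k T) (α : Quiver.Total V) (x : T.P α.hom)
    (v : M.obj.obj (Free.of k (.inner α.hom x))) : v ∈ M.threadPart α (.inner α.hom x) := by
  rw [show M.threadPart α (.inner α.hom x) = ⊤ from if_pos rfl]
  exact Submodule.mem_top

theorem threadPart_of_notMem (M : RepPwf.{w} k T) (α : Quiver.Total V) {X : T.Obj}
    (h : X ∉ Set.range (Obj.inner (T := T) α.hom)) : M.threadPart α X = ⊥ := by
  rcases X with a | ⟨β, x⟩
  · rfl
  · exact if_neg (by rintro rfl; exact h ⟨x, rfl⟩)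

/-- Only the maps `within` a thread avoid the vertices. All other path-like elements factor through
a vertex, where `M` is zero. -/
theorem IsNoise.act_mem_threadPart {M : RepPwf.{w} k T} (hM : M.IsNoise) (α : Quiver.Total V)
    ⦃X Y : T.Obj⦄ (f : X ⟶ Y) : ∀ v ∈ M.threadPart α X, M.act f v ∈ M.threadPart α Y := by
  intro v hv
  have hzero : ∀ {Z W : T.Obj} (b : V) (g : Z ⟶ Obj.vertex b) (h : Obj.vertex b ⟶ W) (v),
      M.act (g ≫ h) v = 0 := by
    intro Z W b g h v
    have := M.isNoise_iff.1 hM b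
    rw [← M.act_act, Subsingleton.elim (M.act g v) 0, map_zero]
  change PathLike T X Y at f
  cases f with
  | path p =>
    exact (hzero _ (PathLike.path p) (𝟙 _) v).symm ▸ Submodule.zero_mem _
  | enter p β y =>
    exact (hzero _ (PathLike.path p) (PathLike.enter .nil β y) v).symm ▸ Submodule.zero_mem _
  | exit β x p =>
    exact (hzero _ (PathLike.exit β x p) (𝟙 _) v).symm ▸ Submodule.zero_mem _
  | @within a b β x y h =>
    by_cases hβ : (⟨a, b, β⟩ : Quiver.Total V) = α
    · subst hβ
      exact M.mem_threadPart_inner ⟨a, b, β⟩ y _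
    · have : v ∈ (⊥ : Submodule k (M.obj.obj (Free.of k (.inner β x)))) := by
        have := hv
        rwa [show M.threadPart α (.inner β x) = ⊥ from if_neg hβ] at this
      obtain rfl : v = 0 := this
      rw [map_zero]
      exact Submodule.zero_mem _
  | through β x p γ y =>
    exact (hzero _ (PathLike.exit β x p) (PathLike.enter .nil γ y) v).symm ▸ Submodule.zero_mem _

/-- The components of the morphism out of a noise representation determined by morphisms out of
its parts along the threads. -/
noncomputable def threadDesc {M : RepPwf.{w} k T}
    {hS : ∀ α ⦃X Y : PathCategory k T⦄ (g : X ⟶ Y), ∀ v ∈ M.threadPart α X,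
      (M.obj.map g).hom v ∈ M.threadPart α Y}
    (s : Cofan fun α => (M.sub (M.threadPart α) (hS α)).obj) :
    ∀ X : T.Obj, M.obj.obj (Free.of k X) ⟶ s.pt.obj (Free.of k X)
  -- For noise the space at a vertex is zero, so this is the only possible value.
  | .vertex _ => 0
  | .inner α x => ModuleCat.ofHom (((s.inj ⟨_, _, α⟩).app (Free.of k (.inner α x))).hom ∘ₗ
      LinearMap.codRestrict (M.threadPart ⟨_, _, α⟩ (.inner α x)) LinearMap.id
        (M.mem_threadPart_inner ⟨_, _, α⟩ x))

theorem threadDesc_apply {M : RepPwf.{w} k T}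
    {hS : ∀ α ⦃X Y : PathCategory k T⦄ (g : X ⟶ Y), ∀ v ∈ M.threadPart α X,
      (M.obj.map g).hom v ∈ M.threadPart α Y}
    (s : Cofan fun α => (M.sub (M.threadPart α) (hS α)).obj) (α : Quiver.Total V) (X : T.Obj)
    {v : M.obj.obj (Free.of k X)} (hv : v ∈ M.threadPart α X) :
    (threadDesc s X).hom v = ((s.inj α).app (Free.of k X)).hom ⟨v, hv⟩ := by
  by_cases h : X ∈ Set.range (Obj.inner (T := T) α.hom)
  · obtain ⟨x, rfl⟩ := h
    rfl
  · obtain rfl : v = 0 := by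
      have := hv
      rwa [M.threadPart_of_notMem α h] at this
    rw [map_zero]
    exact (map_zero ((s.inj α).app (Free.of k X)).hom).symm

theorem IsNoise.exists_isSumOf {M : RepPwf.{w} k T} (hM : M.IsNoise) :
    ∃ U : Quiver.Total V → RepPwf.{w} k T, M.IsSumOf U ∧
      ∀ α, (U α).support ⊆ Set.range (Obj.inner (T := T) α.hom) := by
  let hS := fun α => M.map_mem_of_act_mem (M.threadPart α) (hM.act_mem_threadPart α)
  refine ⟨fun α => M.sub (M.threadPart α) (hS α), ⟨fun α => M.subι _ (hS α), ?_⟩, ?_⟩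
  · refine ⟨Cofan.IsColimit.mk _ (fun s => ⟨threadDesc s, ?_⟩) ?_ ?_⟩
    · intro X Y g
      ext v
      rcases (X : T.Obj) with a | ⟨α, x⟩
      · obtain rfl : v = 0 := (M.isNoise_iff.1 hM a).elim _ _
        rw [map_zero, map_zero]
      · let A : Quiver.Total V := ⟨_, _, α⟩
        have hv := M.mem_threadPart_inner A x v
        -- A vector on the thread of `A` stays in `threadPart A` under `g`, so naturality reduces to
        -- that of the single component `s.inj A`.
        exact ((threadDesc_apply s A Y (hS A g v hv)).trans
          (congrArg (fun h => h.hom ⟨v, hv⟩) ((s.inj A).naturality g))).trans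
          (congrArg (s.pt.map g).hom (threadDesc_apply s A _ hv).symm)
    · intro s α
      ext X v
      exact threadDesc_apply s α X v.2
    · intro s m hm
      ext X v
      rcases (X : T.Obj) with a | ⟨α, x⟩
      · obtain rfl : v = 0 := (M.isNoise_iff.1 hM a).elim _ _
        rw [map_zero, map_zero]
      · let A : Quiver.Total V := ⟨_, _, α⟩
        have hv := M.mem_threadPart_inner A x v
        exact (congrArg (fun h => (h.app (Free.of k (.inner α x))).hom ⟨v, hv⟩) (hm A)).trans
          (threadDesc_apply s A _ hv).symm
  · intro α X hX
    by_contra h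
    have hX' : Nontrivial (M.threadPart α X) := hX
    rw [M.threadPart_of_notMem α h] at hX'
    exact not_subsingleton _
      (Unique.instSubsingleton (α := (⊥ : Submodule k (M.obj.obj (Free.of k X)))))

end Arrows
end RepPwf
end Threading

theorem mainTheorem1 {k : Type uk} [Field k] {V : Type u} [Quiver.{v} V]
    (T : Threading.{uP} V) (M : Threading.RepPwf.{w} k T) :
    -- existence of the decomposition
    (∃ MNF MN : Threading.RepPwf.{w} k T, M.IsSum MNF MN ∧ MNF.IsNoiseFree ∧ MN.IsNoise) ∧
    -- uniqueness up to isomorphism of the two summands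
    (∀ MNF MN MNF' MN' : Threading.RepPwf.{w} k T,
      M.IsSum MNF MN → MNF.IsNoiseFree → MN.IsNoise →
      M.IsSum MNF' MN' → MNF'.IsNoiseFree → MN'.IsNoise →
      Nonempty (MNF ≅ MNF') ∧ Nonempty (MN ≅ MN')) ∧
    -- the noise summand is a direct sum over the arrows, each term supported inside its arrow
    (∀ MNF MN : Threading.RepPwf.{w} k T,
      M.IsSum MNF MN → MNF.IsNoiseFree → MN.IsNoise →
      ∃ U : Quiver.Total V → Threading.RepPwf.{w} k T,
        MN.IsSumOf U ∧
        ∀ α : Quiver.Total V, (U α).support ⊆ Set.range (Threading.Obj.inner (T := T) α.hom)) := by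
  obtain ⟨MNF, MN, h, hNF, hN⟩ := M.exists_isSum_isThreadExact_isNoise
  exact ⟨⟨MNF, MN, h, hNF.isNoiseFree, hN⟩,
    fun _ _ _ _ h hX hY h' hX' hY' =>
      Threading.RepPwf.nonempty_iso_of_isSum h hX hY h' hX' hY',
    fun _ _ _ _ hN => hN.exists_isSumOf⟩
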